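/- Let $d,\delta,\rho$ be integers with $1\le\rho<d$ and $\delta\ge 3$. The environment $\mathcal E=\mathcal E(d,\delta,\rho)$ is the rooted tree of depth $d$ in which every vertex at distance less than $d$ from the root $r$ has exactly $\delta$ children; its edges are segments of length $1$, so that it is a metric space with the path distance. The perimeter vertices are those at distance $\rho$ from $r$, and the leaves are those at distance $d$. An input instance $\mathcal I$ is a finite collection of intruders, each released at some leaf at some time $t\ge 0$; from then on it moves at constant speed $v$ towards the nearest perimeter vertex, and it is lost when it reaches that vertex without having been captured. A single defender starts at $r$ at time $0$ and moves in the tree with speed at most $1$. It captures an intruder if, at some time not later than the intruder's arrival at its perimeter vertex, their locations coincide (capture exactly on the perimeter vertex counts). A (deterministic) online algorithm $\mathcal A$ determines the motion of the defender from the instance so that the defender's position at any time $t$ depends only on the locations of the intruders in the environment at times up to $t$. Let $\mathcal A(\mathcal I)$ be the number of intruders of $\mathcal I$ that it captures, and let $\mathcal O(\mathcal I)$ be the largest number of intruders of $\mathcal I$ captured by any motion of the defender chosen with knowledge of the whole instance. Put $$c_{\mathcal A}(\mathcal E)=\sup_{\mathcal I}\frac{\mathcal O(\mathcal I)}{\mathcal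 A(\mathcal I)},\qquad c(\mathcal E)=\inf_{\mathcal A}c_{\mathcal A}(\mathcal E),$$ where the ratio is $\infty$ if $\mathcal A(\mathcal I)=0<\mathcal O(\mathcal I)$, and instances with $\mathcal O(\mathcal I)=0$ are disregarded. **Theorem.** Suppose that $$\frac{d-\rho}{d+3\rho}\le v<\frac{d-\rho}{d+\rho}$$ and, with $\epsilon=d+3\rho-\frac{d-\rho}{v}$, $$d+\rho+2(d-\rho)\frac{1-v}{1+v}-\frac{2\epsilon v}{1+v}>\frac{d-\rho}{v}.$$ Then $c(\mathcal E)\ge\frac32$. -/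

import Mathlib

open scoped NNReal ENNReal

namespace TreeDefense

/-- The length of the longest common prefix of two words. -/
def lcp {α : Type} [DecidableEq α] : List α → List α → ℕ
  | a :: u, b :: w => if a = b then lcp u w + 1 else 0
  | _, _ => 0

theorem lcp_self {α : Type} [DecidableEq α] (u : List α) : lcp u u = u.length := by
  induction u with
  | nil => rfl
  | cons a u ih => simp [lcp, ih]

theorem lcp_comm {α : Type} [DecidableEq α] (u w : List α) : lcp u w = lcp w u := by
  induction u generalizing w with
  | nil => cases w <;> rfl
  | cons a u ih =>
    cases w with
    | nil => rfl
    | cons b w => simp only [lcp, ih w, eq_comm]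

theorem min_lcp_le {α : Type} [DecidableEq α] (u w z : List α) :
    min (lcp u w) (lcp w z) ≤ lcp u z := by
  induction u generalizing w z with
  | nil => cases w <;> simp [lcp]
  | cons a u ih =>
    cases w with
    | nil => simp [lcp]
    | cons b w =>
      cases z with
      | nil => simp [lcp]
      | cons c z =>
        have := ih w z
        simp only [lcp]
        split_ifs <;> first | omega | (subst_vars; contradiction)

theorem eq_of_length_le_lcp {α : Type} [DecidableEq α] (u w : List α)
    (hu : u.length ≤ lcp u w) (hw : w.length ≤ lcp u w) : u = w := by
  induction u generalizing w with
  | nil => cases w with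
    | nil => rfl
    | cons b w => simp [lcp] at hw
  | cons a u ih =>
    cases w with
    | nil => simp [lcp] at hu
    | cons b w =>
      simp only [lcp] at hu hw
      split_ifs at hu hw with h
      · simp only [List.length_cons, add_le_add_iff_right] at hu hw
        rw [h, ih w hu hw]
      · simp at hu

/-- The locations in the full tree of depth `d` and branching factor `δ`, whose edges are segments
of length one.  The vertices are the words of length at most `d` over `Fin δ`: the root is the empty
word, the children of a vertex `u` of length less than `d` are the `δ` words `u ++ [a]`, and the
leaves are the words of length `d`.  An edge is named by its endpoint away from the root, so it is a
nonempty word.  A location is given by its distance `depth` from the root and by `vertex`: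
the location `(e, l)` with `0 < l ≤ 1` on the edge `e` has `vertex = e` and
`depth = e.length - 1 + l`, while the root has `vertex = []` and `depth = 0`. In particular each
vertex `u` is the location with `vertex = u` and `depth = u.length`. -/
@[ext]
structure Location (d δ : ℕ) where
  vertex : List (Fin δ)
  depth : ℝ
  depth_nonneg : 0 ≤ depth
  depth_le : depth ≤ d
  length_eq : vertex.length = ⌈depth⌉₊

namespace Location

variable {d δ : ℕ}

/-- The depth at which the paths from the root to `x` and to `y` separate. -/
noncomputable def meet (x y : Location d δ) : ℝ :=
  min (lcp x.vertex y.vertex : ℝ) (min x.depth y.depth)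

/-- The length of the shortest path between two locations along the edges of the tree: it ascends
from `x` to the depth where the two root paths separate and descends to `y`. -/
noncomputable instance : MetricSpace (Location d δ) where
  dist x y := x.depth + y.depth - 2 * meet x y
  dist_self x := by
    have h : x.depth ≤ (lcp x.vertex x.vertex : ℝ) := by
      rw [lcp_self, x.length_eq]; exact Nat.le_ceil _
    simp only [meet, min_self, min_eq_right h]; ring
  dist_comm x y := by
    simp only [meet, lcp_comm x.vertex y.vertex, min_comm x.depth y.depth]; ring
  dist_triangle x y z := by
    have h1 : meet x y ≤ y.depth := (min_le_right _ _).trans (min_le_right _ _)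
    have h2 : meet y z ≤ y.depth := (min_le_right _ _).trans (min_le_left _ _)
    have h3 : min (meet x y) (meet y z) ≤ meet x z := by
      have h := min_lcp_le x.vertex y.vertex z.vertex
      have h' : min (lcp x.vertex y.vertex : ℝ) (lcp y.vertex z.vertex) ≤
          (lcp x.vertex z.vertex : ℝ) := by exact_mod_cast h
      refine le_min (le_trans ?_ h') (le_min ?_ ?_)
      · exact min_le_min (min_le_left _ _) (min_le_left _ _)
      · exact (min_le_left _ _).trans ((min_le_right _ _).trans (min_le_left _ _))
      · exact (min_le_right _ _).trans ((min_le_right _ _).trans (min_le_right _ _))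
    rcases min_le_iff.1 h3 with h | h <;> linarith
  eq_of_dist_eq_zero := by
    intro x y h
    have h : x.depth + y.depth - 2 * meet x y = 0 := h
    have h1 : meet x y ≤ x.depth := (min_le_right _ _).trans (min_le_left _ _)
    have h2 : meet x y ≤ y.depth := (min_le_right _ _).trans (min_le_right _ _)
    have h3 : meet x y ≤ lcp x.vertex y.vertex := min_le_left _ _
    have hx : x.vertex.length ≤ lcp x.vertex y.vertex := by
      rw [x.length_eq]; exact Nat.ceil_le.2 (by linarith)
    have hy : y.vertex.length ≤ lcp x.vertex y.vertex := by
      rw [y.length_eq]; exact Nat.ceil_le.2 (by linarith)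
    exact Location.ext (eq_of_length_le_lcp _ _ hx hy) (by linarith)

/-- The root of the tree. -/
def root (d δ : ℕ) : Location d δ := ⟨[], 0, le_rfl, Nat.cast_nonneg d, by simp⟩

/-- The location at distance `h` from the root on the path from the root to the leaf `ℓ`
(`h` is truncated to the range from `0` to `d`). -/
noncomputable def onPath (ℓ : {w : List (Fin δ) // w.length = d}) (h : ℝ) : Location d δ where
  vertex := ℓ.1.take ⌈max 0 (min h d)⌉₊
  depth := max 0 (min h d)
  depth_nonneg := le_max_left _ _
  depth_le := max_le (Nat.cast_nonneg d) (min_le_right _ _)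
  length_eq := by
    rw [List.length_take, ℓ.2]
    exact min_eq_left (Nat.ceil_le.2 (max_le (Nat.cast_nonneg d) (min_le_right _ _)))

end Location

/-- An intruder, given by its release time and by the leaf at which it enters. -/
structure Intruder (d δ : ℕ) where
  time : ℝ≥0
  entrance : {w : List (Fin δ) // w.length = d}

/-- An input instance: finitely many intruders; several may be released at the same time, also at
the same leaf. -/
abbrev Instance (d δ : ℕ) : Type := Multiset (Intruder d δ)

namespace Intruder

variable {d δ : ℕ}

/-- The depth at time `t` of an intruder that moves at speed `v` towards the root. -/
noncomputable def depthAt (v : ℝ) (i : Intruder d δ) (t : ℝ≥0) : ℝ := d - v * (t - i.time)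

/-- At time `t` the intruder has been released and has not gone beyond its perimeter vertex, the
ancestor at depth `ρ` of its entrance (it may be exactly on that vertex). -/
def IsPresent (ρ : ℕ) (v : ℝ) (i : Intruder d δ) (t : ℝ≥0) : Prop :=
  i.time ≤ t ∧ (ρ : ℝ) ≤ i.depthAt v t

/-- The location of the intruder at a time at which it is present. -/
noncomputable def location (v : ℝ) (i : Intruder d δ) (t : ℝ≥0) : Location d δ :=
  Location.onPath i.entrance (i.depthAt v t)

end Intruder

open Classical in
/-- The locations (with multiplicity) of the intruders in the environment at time `t`. -/
noncomputable def intruderLocations {d δ : ℕ} (ρ : ℕ) (v : ℝ) (I : Instance d δ) (t : ℝ≥0) :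
    Multiset (Location d δ) :=
  (I.filter fun i => i.IsPresent ρ v t).map fun i => i.location v t

/-- A motion of the defender: it starts at the root at time `0` and has speed at most `1`. -/
structure Trajectory (d δ : ℕ) where
  pos : ℝ≥0 → Location d δ
  start : pos 0 = Location.root d δ
  speed : LipschitzWith 1 pos

/-- The intruder is captured: at some time the defender is at its location, at the latest when the
intruder arrives at its perimeter vertex. -/
def Trajectory.Captures {d δ : ℕ} (x : Trajectory d δ) (ρ : ℕ) (v : ℝ) (i : Intruder d δ) : Prop :=
  ∃ t : ℝ≥0, i.IsPresent ρ v t ∧ x.pos t = i.location v t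

open Classical in
/-- The number of intruders of the instance `I` that are captured by the motion `x`. -/
noncomputable def Trajectory.captured {d δ : ℕ} (x : Trajectory d δ) (ρ : ℕ) (v : ℝ)
    (I : Instance d δ) : ℕ :=
  (I.filter fun i => x.Captures ρ v i).card

/-- The number of intruders of `I` captured by an optimal offline algorithm, which knows all
of `I` in advance and so can choose any motion. -/
noncomputable def offlineCaptured {d δ : ℕ} (ρ : ℕ) (v : ℝ) (I : Instance d δ) : ℝ≥0∞ :=
  ⨆ x : Trajectory d δ, (x.captured ρ v I : ℝ≥0∞)

/-- A (deterministic) online algorithm: the position of the defender at time `t` depends only on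
the locations of the intruders in the environment at the times up to `t`. -/
structure OnlineAlgorithm (d δ ρ : ℕ) (v : ℝ) where
  motion : Instance d δ → Trajectory d δ
  causal : ∀ (I J : Instance d δ) (t : ℝ≥0),
    (∀ s ≤ t, intruderLocations ρ v I s = intruderLocations ρ v J s) →
      (motion I).pos t = (motion J).pos t

/-- The competitive ratio of an online algorithm: the supremum over all instances of the ratio of
the numbers of intruders captured by an optimal offline algorithm and by the online algorithm.
The ratio is `∞` when only the latter number is `0`; instances for which both are `0` contribute
`0`, which does not affect the supremum. -/
noncomputable def OnlineAlgorithm.competitiveRatio {d δ ρ : ℕ} {v : ℝ}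
    (A : OnlineAlgorithm d δ ρ v) : ℝ≥0∞ :=
  ⨆ I : Instance d δ, offlineCaptured ρ v I / ((A.motion I).captured ρ v I : ℝ≥0∞)

/-- The competitive ratio of the environment with depth `d`, branching factor `δ` and perimeter
depth `ρ`, for intruders of speed `v`. -/
noncomputable def competitiveRatio (d δ ρ : ℕ) (v : ℝ) : ℝ≥0∞ :=
  ⨅ A : OnlineAlgorithm d δ ρ v, A.competitiveRatio

end TreeDefense

/-!
Time is measured so that an intruder needs `T = (d - ρ) / v` from its leaf to the perimeter, and
the bounds on `v` say `d + ρ < T ≤ d + 3ρ`.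

Whatever the online defender does while no intruder is present, at time `d` it lies in at most one
of the subtrees hanging from the root, so two other subtrees, say `b` and `c`, do not contain it.
The adversary releases one intruder at a leaf of `b` and one at a leaf of `c` at time `d`, and a
third one in another subtree `a` at time `2R + ρ - T`, where `R = 2d / (1 + v)`.

* Knowing this, a defender can stand on the leaf of `b` at time `d`, and from there run straight to
  the intruder of `c`, which it meets at time `d + R`, and then straight to the perimeter vertex of
  `a`, which it reaches together with the third intruder.  The intruder of `c` has not yet arrived
  at the perimeter at time `d + R` because `d + ρ < T`.  So all three are captured
  (`exists_trajectory_captures`).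
* The online defender is outside `b` and `c` at time `d`, hence makes its first capture there
  strictly later.  The schedule above is tight, so after a late first capture the order
  "`b` and `c`, then `a`" fails.  Because `T ≤ d + 3ρ`, visiting `a` between them takes too long,
  and the third intruder is released after time `d`, which makes visiting `a` first too long as well
  (`capture_times_inconsistent`).  So it captures at most two.

The ratio of this instance is therefore at least `3 / 2` for every online algorithm.
-/

namespace TreeDefense

/-! ### Distances in the tree -/

theorem lcp_replicate_eq_zero {α : Type} [DecidableEq α] {u : List α} {a : α}
    (h : u.head? ≠ some a) (n : ℕ) : lcp u (List.replicate n a) = 0 := by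
  cases u with
  | nil => simp [lcp]
  | cons b u => cases n with
    | zero => simp [lcp]
    | succ n => simp_all [lcp, List.replicate_succ]

theorem min_le_lcp_take {α : Type} [DecidableEq α] (l : List α) (m n : ℕ)
    (hm : m ≤ l.length) (hn : n ≤ l.length) : min m n ≤ lcp (l.take m) (l.take n) := by
  induction l generalizing m n with
  | nil => simp_all
  | cons a l ih =>
    cases m with
    | zero => simp
    | succ m =>
      cases n with
      | zero => simp
      | succ n =>
        have := ih m n (by simpa using hm) (by simpa using hn)
        simp only [List.take_succ_cons, lcp, if_true]
        omega

namespace Location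

variable {d δ : ℕ}

theorem dist_def (x y : Location d δ) : dist x y = x.depth + y.depth - 2 * meet x y := rfl

theorem dist_le_add (x y : Location d δ) : dist x y ≤ x.depth + y.depth := by
  have : 0 ≤ meet x y := le_min (Nat.cast_nonneg _) (le_min x.depth_nonneg y.depth_nonneg)
  rw [dist_def]; linarith

theorem dist_eq_add {x y : Location d δ} (h : lcp x.vertex y.vertex = 0) :
    dist x y = x.depth + y.depth := by
  have : meet x y = 0 := by
    simp [meet, h, x.depth_nonneg, y.depth_nonneg]
  rw [dist_def, this]; ring

theorem onPath_depth (ℓ : {w : List (Fin δ) // w.length = d}) {h : ℝ} (h0 : 0 ≤ h) (hd : h ≤ d) :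
    (onPath ℓ h).depth = h := by
  simp [onPath, h0, hd]

theorem onPath_depth_le (ℓ : {w : List (Fin δ) // w.length = d}) {h : ℝ} (h0 : 0 ≤ h) :
    (onPath ℓ h).depth ≤ h := max_le h0 (min_le_left _ _)

theorem onPath_zero (ℓ : {w : List (Fin δ) // w.length = d}) : onPath ℓ 0 = root d δ := by
  ext1 <;> simp [onPath, root]

theorem dist_onPath_le (ℓ : {w : List (Fin δ) // w.length = d}) (h h' : ℝ) :
    dist (onPath ℓ h) (onPath ℓ h') ≤ |h - h'| := by
  set x := onPath ℓ h
  set y := onPath ℓ h'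
  have hx : x.depth = max 0 (min h d) := rfl
  have hy : y.depth = max 0 (min h' d) := rfl
  have hm : min x.depth y.depth ≤ meet x y := by
    refine le_min ?_ le_rfl
    have hle : ∀ z : Location d δ, ⌈z.depth⌉₊ ≤ ℓ.1.length := fun z => by
      rw [ℓ.2]; exact Nat.ceil_le.2 z.depth_le
    have := min_le_lcp_take ℓ.1 ⌈x.depth⌉₊ ⌈y.depth⌉₊ (hle x) (hle y)
    calc min x.depth y.depth ≤ min (⌈x.depth⌉₊ : ℝ) ⌈y.depth⌉₊ :=
          min_le_min (Nat.le_ceil _) (Nat.le_ceil _)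
      _ ≤ (lcp x.vertex y.vertex : ℝ) := by exact_mod_cast this
  have hxy : |x.depth - y.depth| ≤ |h - h'| := by
    rw [hx, hy, max_comm 0, max_comm 0]
    exact (abs_max_sub_max_le_abs _ _ _).trans
      ((abs_min_sub_min_le_max h d h' d).trans (by simp))
  rw [dist_def]
  rcases le_total x.depth y.depth with hle | hle
  · rw [min_eq_left hle] at hm
    rw [abs_of_nonpos (by linarith)] at hxy
    linarith
  · rw [min_eq_right hle] at hm
    rw [abs_of_nonneg (by linarith)] at hxy
    linarith

end Location

/-- The leaf reached from the root by always taking the child with index `a`.  One leaf in each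
subtree of the root suffices for the adversary. -/
def leaf (d : ℕ) {δ : ℕ} (a : Fin δ) : {w : List (Fin δ) // w.length = d} :=
  ⟨List.replicate d a, List.length_replicate⟩

namespace Location

variable {d δ : ℕ}

theorem dist_onPath_leaf {x : Location d δ} {a : Fin δ} (hx : x.vertex.head? ≠ some a) {h : ℝ}
    (h0 : 0 ≤ h) (hd : h ≤ d) : dist x (onPath (leaf d a) h) = x.depth + h := by
  rw [dist_eq_add, onPath_depth _ h0 hd]
  simp only [onPath, leaf, List.take_replicate]
  exact lcp_replicate_eq_zero hx _

theorem head?_onPath_leaf_ne {a b : Fin δ} (hab : a ≠ b) (h : ℝ) :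
    (onPath (leaf d a) h).vertex.head? ≠ some b := by
  simp only [onPath, leaf, List.take_replicate, List.head?_replicate]
  split_ifs <;> simp [hab]

theorem dist_onPath_leaf_leaf {a b : Fin δ} (hab : a ≠ b) {h h' : ℝ} (h0 : 0 ≤ h) (hd : h ≤ d)
    (h0' : 0 ≤ h') (hd' : h' ≤ d) :
    dist (onPath (leaf d a) h) (onPath (leaf d b) h') = h + h' := by
  rw [dist_onPath_leaf (head?_onPath_leaf_ne hab h) h0' hd', onPath_depth _ h0 hd]

end Location

/-! ### The offline motion -/

open Location in
/-- The motion that starts at the root and returns to it at the times `z₁ ≤ z₂`: it makes an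
excursion towards `ℓ₁`, then one towards `ℓ₂`, and from `z₂` on runs towards `ℓ₃`, always at full
speed and turning back halfway through each interval. Its depth is the
distance of the time to `{0, z₁, z₂}`, truncated at `d`. -/
noncomputable def excursions {d δ : ℕ} (ℓ₁ ℓ₂ ℓ₃ : {w : List (Fin δ) // w.length = d}) (z₁ z₂ : ℝ) :
    Trajectory d δ where
  pos t := onPath (if (t : ℝ) ≤ z₁ then ℓ₁ else if (t : ℝ) ≤ z₂ then ℓ₂ else ℓ₃)
    (min (t : ℝ) (min |t - z₁| |t - z₂|))
  start := by
    rw [NNReal.coe_zero, min_eq_left (le_min (abs_nonneg _) (abs_nonneg _)), onPath_zero]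
  speed := by
    set f : ℝ≥0 → ℝ := fun t => min (t : ℝ) (min |t - z₁| |t - z₂|)
    have hf : ∀ s t, |f s - f t| ≤ |(s : ℝ) - t| := fun s t => by
      refine (abs_min_sub_min_le_max _ _ _ _).trans (max_le le_rfl ?_)
      refine (abs_min_sub_min_le_max _ _ _ _).trans (max_le ?_ ?_) <;>
        exact (abs_abs_sub_abs_le_abs_sub _ _).trans (le_of_eq (by rw [sub_sub_sub_cancel_right]))
    have hf0 : ∀ t, 0 ≤ f t := fun t => le_min t.2 (le_min (abs_nonneg _) (abs_nonneg _))
    have hz₁ : ∀ t, f t ≤ |(t : ℝ) - z₁| := fun t => (min_le_right _ _).trans (min_le_left _ _)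
    have hz₂ : ∀ t, f t ≤ |(t : ℝ) - z₂| := fun t => (min_le_right _ _).trans (min_le_right _ _)
    -- Two times assigned to different subtrees are separated by a visit to the root.
    have key : ∀ (ℓ ℓ' : {w : List (Fin δ) // w.length = d}) (s t : ℝ≥0) (z : ℝ),
        f s ≤ |(s : ℝ) - z| → f t ≤ |(t : ℝ) - z| → (s : ℝ) ≤ z → z ≤ t →
        dist (onPath ℓ (f s)) (onPath ℓ' (f t)) ≤ |(s : ℝ) - t| := fun ℓ ℓ' s t z hs ht hsz hzt => by
      have h := dist_le_add (onPath ℓ (f s)) (onPath ℓ' (f t))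
      have := onPath_depth_le ℓ (hf0 s)
      have := onPath_depth_le ℓ' (hf0 t)
      rw [abs_of_nonpos (by linarith)] at hs ⊢
      rw [abs_of_nonneg (by linarith)] at ht
      linarith
    have main : ∀ s t : ℝ≥0, (s : ℝ) ≤ t →
        dist (onPath (if (s : ℝ) ≤ z₁ then ℓ₁ else if (s : ℝ) ≤ z₂ then ℓ₂ else ℓ₃) (f s))
          (onPath (if (t : ℝ) ≤ z₁ then ℓ₁ else if (t : ℝ) ≤ z₂ then ℓ₂ else ℓ₃) (f t))
          ≤ |(s : ℝ) - t| := fun s t hst => by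
      have same := fun ℓ => (dist_onPath_le (d := d) (δ := δ) ℓ (f s) (f t)).trans (hf s t)
      by_cases hs₁ : (s : ℝ) ≤ z₁ <;> by_cases ht₁ : (t : ℝ) ≤ z₁ <;>
        by_cases hs₂ : (s : ℝ) ≤ z₂ <;> by_cases ht₂ : (t : ℝ) ≤ z₂ <;>
        simp only [hs₁, hs₂, ht₁, ht₂, if_true, if_false] <;>
        first
          | exact same _
          | exact key _ _ s t z₁ (hz₁ s) (hz₁ t) hs₁ (not_le.1 ht₁).le
          | exact key _ _ s t z₂ (hz₂ s) (hz₂ t) hs₂ (not_le.1 ht₂).le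
          | linarith
    refine LipschitzWith.of_dist_le_mul fun s t => ?_
    rw [NNReal.coe_one, one_mul, NNReal.dist_eq]
    rcases le_total (s : ℝ) t with h | h
    · exact main s t h
    · exact (dist_comm _ _).trans_le ((main t s h).trans_eq (abs_sub_comm _ _))

/-- A motion that is at the root at the times `0`, `2d` and `2R` captures all three: the
first intruder is met on its leaf at time `d`, the second at the halfway time `d + R` of the second
excursion, and the third on the perimeter at time `2R + ρ`. -/
theorem exists_trajectory_captures {d δ ρ : ℕ} {v R : ℝ} (hρ : 0 < ρ) (hρd : ρ < d) (hv : 0 < v)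
    (hR : R * (1 + v) = 2 * d) (hRρ : v * R ≤ d - ρ) (i j k : Intruder d δ)
    (hi : (i.time : ℝ) = d) (hj : (j.time : ℝ) = d)
    (hk : (k.time : ℝ) = 2 * R + ρ - (d - ρ) / v) :
    ∃ x : Trajectory d δ, x.Captures ρ v i ∧ x.Captures ρ v j ∧ x.Captures ρ v k := by
  have hρd' : (ρ : ℝ) < d := by exact_mod_cast hρd
  have hρ0 : (0 : ℝ) < ρ := by exact_mod_cast hρ
  have hdpos : (0 : ℝ) < d := by linarith
  have hdR : (d : ℝ) < R := by linarith
  have hT : v * ((d - ρ) / v) = d - ρ := by field_simp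
  have hTpos : 0 < ((d : ℝ) - ρ) / v := div_pos (by linarith) hv
  obtain ⟨s, hs⟩ : ∃ s : ℝ≥0, (s : ℝ) = d + R := ⟨⟨d + R, by linarith⟩, rfl⟩
  obtain ⟨t, ht⟩ : ∃ t : ℝ≥0, (t : ℝ) = 2 * R + ρ := ⟨⟨2 * R + ρ, by linarith⟩, rfl⟩
  refine ⟨excursions i.entrance j.entrance k.entrance (2 * d) (2 * R),
    ⟨d, ?_, ?_⟩, ⟨s, ?_, ?_⟩, ⟨t, ?_, ?_⟩⟩
  · refine ⟨by exact_mod_cast hi.le, ?_⟩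
    simp [Intruder.depthAt, hi, hρd'.le]
  · have e1 : ((d : ℝ) - 2 * d) = -d := by ring
    simp only [excursions, Intruder.location, Intruder.depthAt, hi, NNReal.coe_natCast]
    rw [if_pos (by linarith), e1, abs_neg, abs_of_pos hdpos, abs_of_nonpos (by linarith),
      min_eq_left (le_min le_rfl (by linarith))]
    simp
  · refine ⟨NNReal.coe_le_coe.1 (by rw [hj, hs]; linarith), ?_⟩
    simp only [Intruder.depthAt, hj, hs, add_sub_cancel_left]
    linarith
  · simp only [excursions, Intruder.location, Intruder.depthAt, hj, hs, add_sub_cancel_left]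
    rw [if_neg (by linarith), if_pos (by linarith), abs_of_nonneg (by linarith),
      abs_of_nonpos (by linarith), min_eq_right (min_le_of_left_le (by linarith)),
      min_eq_left (by linarith)]
    congr 1
    linarith
  · refine ⟨NNReal.coe_le_coe.1 (by rw [hk, ht]; linarith), ?_⟩
    simp only [Intruder.depthAt, hk, ht, sub_sub_cancel]
    linarith
  · simp only [excursions, Intruder.location, Intruder.depthAt, hk, ht, sub_sub_cancel,
      add_sub_cancel_left]
    rw [if_neg (by linarith), if_neg (by linarith), abs_of_nonneg (by linarith),
      abs_of_nonneg (by linarith), min_eq_right (a := 2 * R + ρ - 2 * (d : ℝ)) (by linarith),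
      min_eq_right (by linarith)]
    congr 1
    linarith

/-! ### The online motion -/

theorem Intruder.IsPresent.depthAt_mem {d δ ρ : ℕ} {v : ℝ} (hv : 0 ≤ v) {i : Intruder d δ}
    {t : ℝ≥0} (h : i.IsPresent ρ v t) : 0 ≤ i.depthAt v t ∧ i.depthAt v t ≤ d := by
  have : (i.time : ℝ) ≤ t := by exact_mod_cast h.1
  refine ⟨(Nat.cast_nonneg ρ).trans h.2, ?_⟩
  simp only [depthAt]
  linarith [mul_nonneg hv (sub_nonneg.2 this)]

theorem Trajectory.dist_pos_le {d δ : ℕ} (x : Trajectory d δ) (s t : ℝ≥0) :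
    dist (x.pos s) (x.pos t) ≤ |(s : ℝ) - t| := by
  simpa [NNReal.dist_eq] using x.speed.dist_le_mul s t

open Classical in
/-- At the release time itself the algorithm already sees the intruders, but it cannot jump. -/
theorem OnlineAlgorithm.pos_eq_of_released_after {d δ ρ : ℕ} {v : ℝ} (A : OnlineAlgorithm d δ ρ v)
    {I : Instance d δ} {t₀ : ℝ≥0} (ht₀ : 0 < t₀) (hI : ∀ i ∈ I, t₀ ≤ i.time) :
    (A.motion I).pos t₀ = (A.motion 0).pos t₀ := by
  have hlt : ∀ t < t₀, (A.motion I).pos t = (A.motion 0).pos t := fun t ht => by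
    refine A.causal I 0 t fun s hs => ?_
    have : I.filter (fun i => i.IsPresent ρ v s) = 0 :=
      Multiset.filter_eq_nil.2 fun i hi h => ((hI i hi).trans (h.1.trans hs)).not_gt ht
    simp [intruderLocations, this]
  have hcl : t₀ ∈ closure (Set.Iio t₀) := by
    rw [closure_Iio' (a := t₀) ⟨0, ht₀⟩]; exact Set.mem_Iic.2 le_rfl
  exact Set.EqOn.closure (s := Set.Iio t₀) (fun t ht => hlt t ht)
    (A.motion I).speed.continuous (A.motion 0).speed.continuous hcl

/-- The travel time constraints on the times `t₁`, `t₂`, `t₃` and the depths `D₁`, `D₂`, `D₃` of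
captures in the three subtrees are contradictory: captures in different subtrees are as far apart
as the sum of their depths, and by `h₁` the first one is that far from any position outside its
subtree held at time `d`.  The cases of the proof are the positions of `t₃` relative to
`t₁ ≤ t₂`. -/
theorem capture_times_inconsistent {d ρ v T R t₁ t₂ t₃ D₁ D₂ D₃ : ℝ} (hd : 0 < d)
    (hρd : ρ < d) (hv : 0 < v) (hv1 : v < 1) (hT : v * T = d - ρ) (hT₂ : T ≤ d + 3 * ρ)
    (hR : R * (1 + v) = 2 * d)
    (hD₁ : D₁ = d - v * (t₁ - d)) (hD₂ : D₂ = d - v * (t₂ - d))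
    (hD₃ : D₃ = d - v * (t₃ - (2 * R + ρ - T)))
    (hr₃ : 2 * R + ρ - T ≤ t₃) (hρ₂ : ρ ≤ D₂) (hρ₃ : ρ ≤ D₃)
    (h₁ : D₁ ≤ t₁ - d) (h₁₂ : D₁ + D₂ ≤ |t₁ - t₂|) (h₁₃ : D₁ + D₃ ≤ |t₁ - t₃|)
    (h₂₃ : D₂ + D₃ ≤ |t₂ - t₃|) (hle : t₁ ≤ t₂) : False := by
  have ht₁ : 0 < t₁ - d := by
    refine (mul_pos_iff_of_pos_right (by linarith : 0 < 1 + v)).1 ?_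
    linarith
  have hlate : 0 < (t₁ - d) * (1 - v) := mul_pos ht₁ (by linarith)
  rw [abs_of_nonpos (by linarith)] at h₁₂
  -- The bounds `ρ ≤ D` are deadlines.
  have hdl₂ : t₂ ≤ d + T := le_of_mul_le_mul_left (by linarith) hv
  have hdl₃ : t₃ ≤ 2 * R + ρ := le_of_mul_le_mul_left (by linarith) hv
  rcases le_total t₃ t₁ with h | h
  · rw [abs_of_nonneg (by linarith)] at h₁₃
    -- The third intruder is released after time `d`, hence `t₁ ≥ d + R`, which is too late to reach
    -- the second one.
    have hw : 0 < 2 * R + ρ - T - d := by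
      refine (mul_pos_iff_of_pos_right (by linarith : 0 < 1 + v)).1 ?_
      have := mul_pos (sub_pos.2 hρd) (sub_pos.2 hv1)
      linarith
    have hvw := mul_pos hv hw
    have hq : 0 ≤ (t₃ - d) * (1 - v) := mul_nonneg (by linarith) (by linarith)
    have hR₁ : R ≤ t₁ - d :=
      le_of_mul_le_mul_right (by linarith) (by linarith : 0 < 1 + v)
    have := mul_nonneg (sub_nonneg.2 hR₁) (by linarith : 0 ≤ 1 - v)
    linarith
  · rw [abs_of_nonpos (by linarith)] at h₁₃
    rcases le_total t₃ t₂ with h' | h'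
    · rw [abs_of_nonneg (by linarith)] at h₂₃
      linarith
    · rw [abs_of_nonpos (by linarith)] at h₂₃
      -- With `t₁ > d`, the second capture misses the tight schedule, whose second capture is at
      -- time `d + R`.
      have hR₂ : R < t₂ - d :=
        lt_of_mul_lt_mul_right (by linarith) (by linarith : 0 ≤ 1 + v)
      have := mul_pos (sub_pos.2 hR₂) (by linarith : 0 < 1 - v)
      linarith

/-- A defender that at time `d` is in neither of the subtrees in which the first two intruders are
released at that time misses one of the three. -/
theorem not_captures_all {d δ ρ : ℕ} {v R : ℝ} (hρd : ρ < d) (hv : 0 < v) (hv1 : v < 1)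
    (hT₂ : (d - ρ) / v ≤ (d : ℝ) + 3 * ρ)
    (hR : R * (1 + v) = 2 * d) {a b c : Fin δ} (hab : a ≠ b) (hac : a ≠ c) (hbc : b ≠ c)
    (x : Trajectory d δ) (hxb : (x.pos d).vertex.head? ≠ some b)
    (hxc : (x.pos d).vertex.head? ≠ some c) (τ : ℝ≥0)
    (hτ : (τ : ℝ) = 2 * R + ρ - (d - ρ) / v) :
    ¬ (x.Captures ρ v ⟨d, leaf d b⟩ ∧ x.Captures ρ v ⟨d, leaf d c⟩ ∧
      x.Captures ρ v ⟨τ, leaf d a⟩) := by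
  rintro ⟨⟨t₁, p₁, e₁⟩, ⟨t₂, p₂, e₂⟩, ⟨t₃, p₃, e₃⟩⟩
  have hρd' : (ρ : ℝ) < d := by exact_mod_cast hρd
  have hd : (0 : ℝ) < d := (Nat.cast_nonneg ρ).trans_lt hρd'
  have hvT : v * (((d : ℝ) - ρ) / v) = d - ρ := by field_simp
  obtain ⟨m₁, n₁⟩ := p₁.depthAt_mem hv.le
  obtain ⟨m₂, n₂⟩ := p₂.depthAt_mem hv.le
  obtain ⟨m₃, n₃⟩ := p₃.depthAt_mem hv.le
  have h₁₂ := x.dist_pos_le t₁ t₂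
  have h₁₃ := x.dist_pos_le t₁ t₃
  have h₂₃ := x.dist_pos_le t₂ t₃
  have h₁ := x.dist_pos_le d t₁
  have h₂ := x.dist_pos_le d t₂
  simp only [e₁, e₂, e₃, Intruder.location] at h₁₂ h₁₃ h₂₃ h₁ h₂
  rw [Location.dist_onPath_leaf_leaf hbc m₁ n₁ m₂ n₂] at h₁₂
  rw [Location.dist_onPath_leaf_leaf hab.symm m₁ n₁ m₃ n₃] at h₁₃
  rw [Location.dist_onPath_leaf_leaf hac.symm m₂ n₂ m₃ n₃] at h₂₃
  rw [Location.dist_onPath_leaf hxb m₁ n₁] at h₁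
  rw [Location.dist_onPath_leaf hxc m₂ n₂] at h₂
  have hx0 := (x.pos d).depth_nonneg
  have r₁ : (d : ℝ) ≤ t₁ := by exact_mod_cast p₁.1
  have r₂ : (d : ℝ) ≤ t₂ := by exact_mod_cast p₂.1
  have r₃ : 2 * R + ρ - ((d : ℝ) - ρ) / v ≤ t₃ := by rw [← hτ]; exact_mod_cast p₃.1
  have q₁ := p₁.2
  have q₂ := p₂.2
  have q₃ := p₃.2
  rw [NNReal.coe_natCast, abs_of_nonpos (by linarith)] at h₁ h₂
  simp only [Intruder.depthAt, NNReal.coe_natCast, hτ] at *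
  rcases le_total (t₁ : ℝ) t₂ with h | h
  · exact capture_times_inconsistent hd hρd' hv hv1 hvT hT₂ hR rfl rfl rfl r₃ q₂ q₃
      (by linarith) h₁₂ h₁₃ h₂₃ h
  · exact capture_times_inconsistent hd hρd' hv hv1 hvT hT₂ hR rfl rfl rfl r₃ q₁ q₃
      (by linarith) (by rwa [add_comm, abs_sub_comm]) h₂₃ h₁₃ h

theorem exists_three_distinct_ne {δ : ℕ} (hδ : 3 ≤ δ) (o : Option (Fin δ)) :
    ∃ a b c : Fin δ, a ≠ b ∧ a ≠ c ∧ b ≠ c ∧ o ≠ some b ∧ o ≠ some c := by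
  obtain ⟨a, ha⟩ : ∃ a, o = some a ∨ o = none := by
    cases o with
    | none => exact ⟨⟨0, by omega⟩, Or.inr rfl⟩
    | some a => exact ⟨a, Or.inl rfl⟩
  have hcard : 1 < (Finset.univ.erase a).card := by
    rw [Finset.card_erase_of_mem (Finset.mem_univ a), Finset.card_univ, Fintype.card_fin]; omega
  obtain ⟨b, hb, c, hc, hbc⟩ := Finset.one_lt_card.1 hcard
  have hab := (Finset.ne_of_mem_erase hb).symm
  have hac := (Finset.ne_of_mem_erase hc).symm
  refine ⟨a, b, c, hab, hac, hbc, ?_, ?_⟩ <;> rcases ha with rfl | rfl <;> simp [hab, hac]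

end TreeDefense

open TreeDefense in

theorem mainTheorem3 (d δ ρ : ℕ) (v ε : ℝ) (hδ : 3 ≤ δ) (hρ : 1 ≤ ρ) (hρd : ρ < d)
    (hv₁ : ((d : ℝ) - ρ) / (d + 3 * ρ) ≤ v) (hv₂ : v < ((d : ℝ) - ρ) / (d + ρ))
    (hε : ε = (d : ℝ) + 3 * ρ - ((d : ℝ) - ρ) / v)
    (h : ((d : ℝ) - ρ) / v <
      (d : ℝ) + ρ + 2 * ((d : ℝ) - ρ) * ((1 - v) / (1 + v)) - 2 * ε * v / (1 + v)) :
    (3 / 2 : ℝ≥0∞) ≤ TreeDefense.competitiveRatio d δ ρ v := by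
  classical
  have hρd' : (ρ : ℝ) < d := by exact_mod_cast hρd
  have hρ' : (1 : ℝ) ≤ ρ := by exact_mod_cast hρ
  have hd : (0 : ℝ) < d := by linarith
  have hv : 0 < v := (div_pos (by linarith) (by linarith)).trans_le hv₁
  rw [div_le_iff₀ (by linarith)] at hv₁
  rw [lt_div_iff₀ (by linarith)] at hv₂
  have hv1 : v < 1 := by nlinarith
  have hT₁ : (d : ℝ) + ρ < (d - ρ) / v := by rw [lt_div_iff₀ hv]; linarith
  have hT₂ : (d - ρ) / v ≤ (d : ℝ) + 3 * ρ := by rw [div_le_iff₀ hv]; linarith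
  obtain ⟨R, hR⟩ : ∃ R : ℝ, R * (1 + v) = 2 * d := ⟨2 * d / (1 + v), by field_simp⟩
  have hRρ : v * R ≤ d - ρ := by nlinarith
  have hτ : (d : ℝ) ≤ 2 * R + ρ - (d - ρ) / v := by linarith
  refine le_iInf fun A => ?_
  obtain ⟨a, b, c, hab, hac, hbc, hb, hc⟩ :=
    exists_three_distinct_ne hδ ((A.motion 0).pos d).vertex.head?
  set i : Intruder d δ := ⟨d, leaf d b⟩ with hi
  set j : Intruder d δ := ⟨d, leaf d c⟩ with hj
  set k : Intruder d δ := ⟨⟨_, hd.le.trans hτ⟩, leaf d a⟩ with hk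
  set I : Instance d δ := {i, j, k} with hI
  have hpos : (A.motion I).pos d = (A.motion 0).pos d := by
    refine A.pos_eq_of_released_after (by exact_mod_cast hd) fun l hl => ?_
    simp only [hI, Multiset.insert_eq_cons, Multiset.mem_cons, Multiset.mem_singleton] at hl
    rcases hl with rfl | rfl | rfl
    · exact le_rfl
    · exact le_rfl
    · exact NNReal.coe_le_coe.1 hτ
  have hoff : (3 : ℝ≥0∞) ≤ offlineCaptured ρ v I := by
    obtain ⟨x, h1, h2, h3⟩ := exists_trajectory_captures hρ hρd hv hR hRρ i j k
      (by simp [hi]) (by simp [hj]) rfl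
    have : x.captured ρ v I = 3 := by
      simp [Trajectory.captured, hI, Multiset.filter_singleton, h1, h2, h3]
    refine le_trans ?_ (le_iSup _ x)
    rw [this]; norm_num
  have hon : ((A.motion I).captured ρ v I : ℝ≥0∞) ≤ 2 := by
    have hlt : (A.motion I).captured ρ v I < 3 := by
      by_contra hge
      have heq : I.filter (fun l => (A.motion I).Captures ρ v l) = I :=
        Multiset.eq_of_le_of_card_le (Multiset.filter_le _ _) (not_lt.1 hge)
      rw [Multiset.filter_eq_self] at heq
      exact not_captures_all hρd hv hv1 hT₂ hR hab hac hbc (A.motion I)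
        (by rwa [hpos]) (by rwa [hpos]) _ rfl
        ⟨heq i (by simp [hI]), heq j (by simp [hI]), heq k (by simp [hI])⟩
    exact_mod_cast Nat.le_of_lt_succ hlt
  exact (ENNReal.div_le_div hoff hon).trans (le_iSup (fun I => offlineCaptured ρ v I /
    ((A.motion I).captured ρ v I : ℝ≥0∞)) I)
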